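/- Let $K$ be a field, let $S=K[x_1,\ldots,x_n]$ and let $I\subset S$ be a monomial ideal with minimal set of monomial generators $G(I)$. Let ${\bf c}=(c_1,\ldots,c_n)$ with $c_i=\max\{\deg_{x_i}u : u\in G(I)\}$ (and ${\bf c}=0$ if $I=0$). Let $S^\wp$ be the polynomial ring over $K$ in the variables $x_{ij}$, $1\le i\le n$, $1\le j\le c_i$; for a monomial $u=x_1^{a_1}\cdots x_n^{a_n}$ with $a_i\le c_i$ for all $i$ put $u^\wp=\prod_{i=1}^n\prod_{j=1}^{a_i}x_{ij}$, and let $I^\wp\subset S^\wp$ be the ideal generated by the $u^\wp$ with $u\in G(I)$. Let ${\bf x}=x_1,\ldots,x_n$ and ${\bf x}^\wp=x_{11},\ldots,x_{1c_1},x_{21},\ldots,x_{nc_n}$. The Koszul complex $K({\bf x};S)$ is the exterior algebra of the free module with basis $e_1,\ldots,e_n$ and differential given by $\partial e_j=x_j$; $K({\bf x};S/I)=K({\bf x};S)\otimes_S S/I$ and $H_i({\bf x};S/I)$ is its homology; and similarly for ${\bf x}^\wp$, with basis elements $e_{ij}$, $\partial e_{ij}=x_{ij}$. For $J=\{j_1<\cdots<j_i\}$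 let $e_J=e_{j_1}\wedge\cdots\wedge e_{j_i}$. The multidegree of $u e_J$, for a monomial $u=x_1^{a_1}\cdots x_n^{a_n}$, is the vector with components $a_k+1$ for $k\in J$ and $a_k$ for $k\notin J$. If it is $\le{\bf c}$ componentwise, put $$(ue_J)^\wp=u^\wp\, e_{j_1,a_{j_1}+1}\wedge\cdots\wedge e_{j_i,a_{j_i}+1}.$$ For a multihomogeneous element $f=\sum_J\lambda_Ju_Je_J$ of multidegree $\le{\bf c}$, with $\lambda_J\in K$, put $f^\wp=\sum_J\lambda_J(u_Je_J)^\wp$. Let $i\ge 1$, and let $z_1,\ldots,z_r\in K_i({\bf x};S)$ be multihomogeneous elements of multidegrees $\le{\bf c}$ (not necessarily the same for all $z_k$) whose images in $K_i({\bf x};S/I)$ are cycles whose homology classes form a $K$-basis of $H_i({\bf x};S/I)$. Then the images of $z_1^\wp,\ldots,z_r^\wp$ in $K_i({\bf x}^\wp;S^\wp/I^\wp)$ are cycles, and their homology classes form a $K$-basis of $H_i({\bf x}^\wp;S^\wp/I^\wp)$. -/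

import Mathlib

/-! ### The Koszul complex of a finite sequence with values in a module -/

namespace Koszul

section

variable {ι : Type*} [LinearOrder ι] [Fintype ι] {R : Type*} [CommRing R]

/-- The sign `(-1)^p`, where `p` is the number of elements of `J` that are smaller than `k`. -/
def sign (R : Type*) [CommRing R] (J : Finset ι) (k : ι) : R :=
  (-1) ^ (J.filter (fun j => j < k)).card

/-- The Koszul differential of the sequence `x` with values in the `R`-module `M`.
The element `∑_J f_J e_J` of `(⋀ F) ⊗ M`, with `F` free on the `e_j`, with `f_J ∈ M` and with
`e_J = e_{j₁} ∧ ⋯ ∧ e_{jᵢ}` for `J = {j₁ < ⋯ < jᵢ}`, is represented by the function `J ↦ f_J`. The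
differential is determined by `∂ (m e_J) = ∑_{k ∈ J} (-1)^{#{j ∈ J | j < k}} x_k m e_{J \ {k}}`. -/
noncomputable def differential (x : ι → R) (M : Type*) [AddCommGroup M] [Module R M] :
    (Finset ι → M) →ₗ[R] (Finset ι → M) :=
  ∑ J : Finset ι, ∑ k ∈ J,
    LinearMap.single R (fun _ : Finset ι => M) (J.erase k) ∘ₗ
      ((sign R J k * x k) • (LinearMap.proj J : (Finset ι → M) →ₗ[R] M))

/-- `K_i(x; M)`: the elements `∑_J f_J e_J` in which only sets `J` of cardinality `i` occur. -/
def chains (ι R M : Type*) [CommRing R] [AddCommGroup M] [Module R M] (i : ℕ) :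
    Submodule R (Finset ι → M) where
  carrier := {f | ∀ J : Finset ι, J.card ≠ i → f J = 0}
  add_mem' := fun {f g} hf hg J hJ => by simp [hf J hJ, hg J hJ]
  zero_mem' := fun _ _ => rfl
  smul_mem' := fun r f hf J hJ => by simp [hf J hJ]

/-- The cycles in `K_i(x; M)`. -/
noncomputable def cycles (x : ι → R) (M : Type*) [AddCommGroup M] [Module R M] (i : ℕ) :
    Submodule R (Finset ι → M) :=
  chains ι R M i ⊓ LinearMap.ker (differential x M)

/-- The boundaries in `K_i(x; M)`, the image of `K_{i+1}(x; M)` under the differential. -/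
noncomputable def boundaries (x : ι → R) (M : Type*) [AddCommGroup M] [Module R M] (i : ℕ) :
    Submodule R (Finset ι → M) :=
  (chains ι R M (i + 1)).map (differential x M)

theorem differential_single (x : ι → R) {M : Type*} [AddCommGroup M] [Module R M]
    (J : Finset ι) (m : M) :
    differential x M (Pi.single J m) =
      ∑ k ∈ J, Pi.single (J.erase k) ((sign R J k * x k) • m) := by
  simp only [differential, LinearMap.sum_apply, LinearMap.comp_apply, LinearMap.smul_apply,
    LinearMap.proj_apply, LinearMap.single_apply]
  rw [Finset.sum_eq_single J]
  · simp
  · intro b _ hb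
    simp [Pi.single_eq_of_ne hb]
  · simp

theorem sign_erase_mul {ι R : Type*} [LinearOrder ι] [CommRing R] (J : Finset ι) {k l : ι}
    (hk : k ∈ J) (hlt : k < l) :
    sign R J k * sign R (J.erase k) l = - (sign R J l * sign R (J.erase l) k) := by
  have h1 : (J.erase l).filter (fun j => j < k) = J.filter (fun j => j < k) := by
    ext j
    simp only [Finset.mem_filter, Finset.mem_erase]
    constructor
    · tauto
    · rintro ⟨h, h'⟩
      exact ⟨⟨(h'.trans hlt).ne, h⟩, h'⟩
  have h2 : (J.erase k).filter (fun j => j < l) = (J.filter (fun j => j < l)).erase k := by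
    ext j
    simp only [Finset.mem_filter, Finset.mem_erase]
    tauto
  have h3 : (((J.filter (fun j => j < l)).erase k).card) + 1
      = (J.filter (fun j => j < l)).card :=
    Finset.card_erase_add_one (by simp [hk, hlt])
  unfold sign
  rw [h1, h2, ← h3, pow_succ]
  ring

theorem differential_differential (x : ι → R) {M : Type*} [AddCommGroup M] [Module R M]
    (f : Finset ι → M) : differential x M (differential x M f) = 0 := by
  have key : differential x M ∘ₗ differential x M = 0 := by
    refine LinearMap.pi_ext fun J m => ?_
    simp only [LinearMap.comp_apply, LinearMap.zero_apply]
    rw [differential_single, map_sum]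
    simp only [differential_single]
    rw [Finset.sum_sigma']
    refine Finset.sum_involution (fun p _ => ⟨p.2, p.1⟩) ?_ ?_ ?_ ?_
    · rintro ⟨k, l⟩ h
      simp only [Finset.mem_sigma, Finset.mem_erase] at h
      obtain ⟨hk, hlk, hl⟩ := h
      simp only [Finset.erase_right_comm (a := l) (b := k), ← Pi.single_add, smul_smul, ← add_smul]
      have : sign R (J.erase k) l * x l * (sign R J k * x k)
          + sign R (J.erase l) k * x k * (sign R J l * x l) = 0 := by
        rcases lt_or_gt_of_ne hlk with h | h
        · have := sign_erase_mul (R := R) J hl h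
          linear_combination (x l * x k) * this
        · have := sign_erase_mul (R := R) J hk h
          linear_combination (x l * x k) * this
      rw [this]
      simp
    · rintro ⟨k, l⟩ h _ heq
      simp only [Finset.mem_sigma, Finset.mem_erase] at h
      simp only [Sigma.mk.injEq] at heq
      exact h.2.1 heq.1
    · rintro ⟨k, l⟩ h
      simp only [Finset.mem_sigma, Finset.mem_erase] at h ⊢
      exact ⟨h.2.2, h.2.1.symm, h.1⟩
    · rintro ⟨k, l⟩ _
      rfl
  exact LinearMap.congr_fun key f

theorem boundaries_le_cycles (x : ι → R) (M : Type*) [AddCommGroup M] [Module R M] (i : ℕ) :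
    boundaries x M i ≤ cycles x M i := by
  rintro _ ⟨f, hf, rfl⟩
  refine ⟨?_, differential_differential x f⟩
  intro J hJ
  simp only [differential, LinearMap.sum_apply, LinearMap.comp_apply, LinearMap.smul_apply,
    LinearMap.proj_apply, LinearMap.single_apply, Finset.sum_apply]
  refine Finset.sum_eq_zero fun A _ => Finset.sum_eq_zero fun k hk => ?_
  by_cases hA : A.card = i + 1
  · refine Pi.single_eq_of_ne ?_ _
    rintro rfl
    exact hJ (by rw [Finset.card_erase_of_mem hk, hA]; rfl)
  · rw [hf A hA]
    simp

/-- The Koszul homology `H_i(x; M)`, the module of cycles modulo the boundaries. -/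
abbrev Homology (x : ι → R) (M : Type*) [AddCommGroup M] [Module R M] (i : ℕ) : Type _ :=
  cycles x M i ⧸ (boundaries x M i).submoduleOf (cycles x M i)

/-- The homology class `[z]` of a cycle `z` in `K_i(x; M)`. -/
noncomputable def homologyClass (x : ι → R) {M : Type*} [AddCommGroup M] [Module R M] (i : ℕ)
    (z : Finset ι → M) (hz : z ∈ cycles x M i) : Homology x M i :=
  Submodule.Quotient.mk ⟨z, hz⟩

/-- The elements `z_k` of `K(x; M)` are cycles in `K_i(x; M)`, and their homology classes form a
`K`-basis of `H_i(x; M)`. -/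
def RepresentBasis (K : Type*) [Field K] [Algebra K R] (x : ι → R) {M : Type*} [AddCommGroup M]
    [Module R M] [Module K M] [IsScalarTower K R M] (i : ℕ) {κ : Type*} (z : κ → Finset ι → M) :
    Prop :=
  ∃ hz : ∀ k, z k ∈ cycles x M i,
    LinearIndependent K (fun k => homologyClass x i (z k) (hz k)) ∧
      Submodule.span K (Set.range fun k => homologyClass x i (z k) (hz k)) = ⊤

end

/-- The canonical map `K(x; R) → K(x; R/I)`, taking residue classes of all coefficients. -/
def residue {ι R : Type*} [CommRing R] (I : Ideal R) (f : Finset ι → R) : Finset ι → R ⧸ I :=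
  fun J => Ideal.Quotient.mk I (f J)

end Koszul

/-! ### Monomial ideals and polarization -/

namespace Polarization

open MvPolynomial

section

variable {K : Type*} [Field K] {n : ℕ}

/-- A monomial ideal is an ideal that is generated by monomials. -/
def IsMonomialIdeal (I : Ideal (MvPolynomial (Fin n) K)) : Prop :=
  ∃ A : Set (Fin n →₀ ℕ), I = Ideal.span ((fun a => monomial a (1 : K)) '' A)

/-- The exponent vectors of `G(I)`: the monomials in `I` that are minimal with respect to
divisibility. For a monomial ideal they form its unique minimal set of monomial generators. -/
def minGens (I : Ideal (MvPolynomial (Fin n) K)) : Set (Fin n →₀ ℕ) :=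
  {a | Minimal (fun b : Fin n →₀ ℕ => monomial b (1 : K) ∈ I) a}

theorem minGens_finite (I : Ideal (MvPolynomial (Fin n) K)) : (minGens I).Finite :=
  WellQuasiOrderedLE.finite_of_isAntichain (setOfPred_minimal_antichain _)

/-- `c_i = max {deg_{x_i} u | u ∈ G(I)}`, which is `0` when `G(I)` is empty, that is, for `I = 0`. -/
noncomputable def maxDeg (I : Ideal (MvPolynomial (Fin n) K)) (i : Fin n) : ℕ :=
  (minGens_finite I).toFinset.sup (fun a => a i)

/-- The index set of the variables `x_{ij}`, `1 ≤ j ≤ c_i`, in the lexicographic order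
`x_{11}, …, x_{1c_1}, x_{21}, …, x_{nc_n}`. The variable `x_{ij}` has the index `(i, j - 1)`. -/
abbrev PolVar (c : Fin n → ℕ) : Type := Σₗ i : Fin n, Fin (c i)

/-- For the monomial `u = x^a` with `a ≤ c`, its polarization
`u^℘ = ∏_{i = 1, …, n} ∏_{j = 1, …, a_i} x_{ij}`. -/
noncomputable def polMonomial (K : Type*) [Field K] (c : Fin n → ℕ) (a : Fin n →₀ ℕ) :
    MvPolynomial (PolVar c) K :=
  ∏ p : PolVar c with ((ofLex p).2 : ℕ) < a (ofLex p).1, X p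

/-- The polarization `I^℘` of the monomial ideal `I`, generated by the `u^℘` with `u ∈ G(I)`. -/
noncomputable def polIdeal (I : Ideal (MvPolynomial (Fin n) K)) :
    Ideal (MvPolynomial (PolVar (maxDeg I)) K) :=
  Ideal.span (polMonomial K (maxDeg I) '' minGens I)

/-- The multidegree of the monomial `x^a e_J` of the Koszul complex: `a_i + 1` at `i ∈ J`, and
`a_i` at `i ∉ J`. -/
def multideg (a : Fin n →₀ ℕ) (J : Finset (Fin n)) (i : Fin n) : ℕ :=
  a i + if i ∈ J then 1 else 0

/-- `f = ∑_J f_J e_J` is multihomogeneous of multidegree `d`: every monomial `x^a e_J` that occurs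
in `f` has the multidegree `d`. -/
def IsMultihomogeneous (f : Finset (Fin n) → MvPolynomial (Fin n) K) (d : Fin n → ℕ) : Prop :=
  ∀ J, ∀ a ∈ (f J).support, multideg a J = d

/-- For a monomial `x^a e_J` of multidegree `≤ c`, the set of the indices `(j, a_j + 1)` with
`j ∈ J` (the second index counts from `0` here); it is the index set of the exterior monomial
`e_{j₁, a_{j₁} + 1} ∧ ⋯ ∧ e_{jᵢ, a_{jᵢ} + 1}`, whose factors are in increasing order. -/
def polIndex (c : Fin n → ℕ) (a : Fin n →₀ ℕ) (J : Finset (Fin n)) : Finset (PolVar c) :=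
  {p : PolVar c | (ofLex p).1 ∈ J ∧ ((ofLex p).2 : ℕ) = a (ofLex p).1}

/-- The polarization `f^℘ = ∑ λ (x^a e_J)^℘` of an element `f = ∑ λ x^a e_J` of the Koszul complex
`K(x; S)`, where `(x^a e_J)^℘ = (x^a)^℘ e_{j₁, a_{j₁} + 1} ∧ ⋯ ∧ e_{jᵢ, a_{jᵢ} + 1}`. It is used
only for elements that are multihomogeneous of a multidegree `≤ c`. -/
noncomputable def polChain (c : Fin n → ℕ) (f : Finset (Fin n) → MvPolynomial (Fin n) K) :
    Finset (PolVar c) → MvPolynomial (PolVar c) K :=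
  ∑ J : Finset (Fin n), ∑ a ∈ (f J).support,
    Pi.single (polIndex c a J) (coeff a (f J) • polMonomial K c a)

end

end Polarization

set_option linter.unusedSectionVars false

/-! ### Koszul homology with coefficients in `R ⧸ I`, computed on lifts to `R`. -/

namespace Koszul

section

variable {ι : Type*} [LinearOrder ι] [Fintype ι] {R : Type*} [CommRing R]

/-! Polarization identifies the part of the Koszul complex of `S` in multidegrees `≤ c` with a
subcomplex of the Koszul complex of `S^℘`, and the whole polarized complex contracts onto that
subcomplex by a homotopy that respects `I^℘`.

Call an index `p` free for `x^E e_J` if it occurs in the multidegree and either occurs at least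
twice or has a predecessor in its row whose variable does not divide `x^E`. A cell without free
indices has in each row an initial run of variables to the first power, possibly followed at once by
one exterior factor; these are exactly the polarizations of cells of multidegree `≤ c`
(`exists_eq_polExp_of_not_isFree`). Signs and the differential match because each row contributes at
most one exterior factor (`polHom_diff`).

Cells for which `p` is free come in pairs `x_p x^E e_J`, `x^E e_{J ∪ {p}}` with `p ∉ J`, and a
one-variable homotopy removes them. Composing over all `p` gives `exists_homotopy_no_free`. A
squarefree generator `u^℘` that divides the first monomial of a pair divides the second: either
`x_p` still divides it, or a predecessor of `p` is missing and then `x_p` does not divide `u^℘`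
(`toggleClosed_polExp`).

So the retraction followed by depolarization carries relations and cycles modulo `I^℘` to such
modulo `I`, where the hypothesis on the `z_k` applies, and polarization carries the outcome back.
Polarization extended by zero is still a chain map, so no separate vanishing of homology outside
multidegrees `≤ c` is needed. The homotopies are only `K`-linear, hence the work with the `K`-basis
of cells `x^a e_J`. -/

theorem mem_chains {M : Type*} [AddCommGroup M] [Module R M] {i : ℕ} {f : Finset ι → M} :
    f ∈ chains ι R M i ↔ ∀ J : Finset ι, J.card ≠ i → f J = 0 :=
  Iff.rfl

/-- The canonical map `K(x; R) → K(x; R/I)` as a linear map. -/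
def residueHom (ι : Type*) {R : Type*} [CommRing R] (I : Ideal R) :
    (Finset ι → R) →ₗ[R] (Finset ι → R ⧸ I) where
  toFun := residue I
  map_add' _ _ := by ext; simp [residue]
  map_smul' r f := by
    ext J
    exact (Ideal.Quotient.mk I).map_mul r (f J)

theorem residueHom_eq_zero_iff {I : Ideal R} {f : Finset ι → R} :
    residueHom ι I f = 0 ↔ ∀ J, f J ∈ I := by
  simp [funext_iff, residueHom, residue, Ideal.Quotient.eq_zero_iff_mem]

theorem residueHom_single (I : Ideal R) (J : Finset ι) (r : R) :
    residueHom ι I (Pi.single J r) = Pi.single J (Ideal.Quotient.mk I r) := by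
  ext A
  by_cases h : A = J
  · subst h; simp [residueHom, residue]
  · simp [residueHom, residue, Pi.single_eq_of_ne h]

theorem differential_residueHom (x : ι → R) (I : Ideal R) (f : Finset ι → R) :
    differential x (R ⧸ I) (residueHom ι I f) = residueHom ι I (differential x R f) := by
  have : differential x (R ⧸ I) ∘ₗ residueHom ι I = residueHom ι I ∘ₗ differential x R := by
    refine LinearMap.pi_ext fun J m => ?_
    simp only [LinearMap.comp_apply, residueHom_single, differential_single, map_sum]
    rfl
  exact LinearMap.congr_fun this f

theorem residueHom_mem_chains {I : Ideal R} {i : ℕ} {f : Finset ι → R}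
    (hf : f ∈ chains ι R R i) : residueHom ι I f ∈ chains ι R (R ⧸ I) i := by
  intro J hJ
  simp [residueHom, residue, hf J hJ]

theorem exists_residueHom_eq {I : Ideal R} {i : ℕ} {g : Finset ι → R ⧸ I}
    (hg : g ∈ chains ι R (R ⧸ I) i) : ∃ f ∈ chains ι R R i, residueHom ι I f = g := by
  choose s hs using fun J => Ideal.Quotient.mk_surjective (g J)
  refine ⟨fun J => if J.card = i then s J else 0, fun J hJ => if_neg hJ, ?_⟩
  ext J
  by_cases h : J.card = i
  · simp [residueHom, residue, h, hs]
  · simp [residueHom, residue, h, hg J h]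

/-- Elements of `K_i(x; R)` represent a `K`-basis of `H_i(x; R/I)` if and only if they do so
modulo the elements of `K(x; R)` with coefficients in `I`. -/
theorem representBasis_residue_iff {K : Type*} [Field K] [Algebra K R] (x : ι → R) (I : Ideal R)
    (i : ℕ) {κ : Type*} [Fintype κ] (z : κ → Finset ι → R) (hz : ∀ k, z k ∈ chains ι R R i) :
    RepresentBasis K x i (fun k => residue I (z k)) ↔
      (∀ k J, differential x R (z k) J ∈ I) ∧
      (∀ l : κ → K, ∀ w ∈ chains ι R R (i + 1),
        (∀ J, (∑ k, l k • z k - differential x R w) J ∈ I) → ∀ k, l k = 0) ∧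
      (∀ g ∈ chains ι R R i, (∀ J, differential x R g J ∈ I) →
        ∃ l : κ → K, ∃ w ∈ chains ι R R (i + 1),
          ∀ J, (g - ∑ k, l k • z k - differential x R w) J ∈ I) := by
  have hcyc : ∀ f ∈ chains ι R R i,
      (residueHom ι I f ∈ cycles x (R ⧸ I) i ↔ ∀ J, differential x R f J ∈ I) := by
    intro f hf
    rw [cycles, Submodule.mem_inf, LinearMap.mem_ker, differential_residueHom,
      residueHom_eq_zero_iff]
    exact and_iff_right (residueHom_mem_chains hf)
  have hbd : ∀ f : Finset ι → R, residueHom ι I f ∈ boundaries x (R ⧸ I) i ↔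
      ∃ w ∈ chains ι R R (i + 1), ∀ J, (f - differential x R w) J ∈ I := by
    intro f
    constructor
    · rintro ⟨w', hw', h⟩
      obtain ⟨w, hw, rfl⟩ := exists_residueHom_eq hw'
      refine ⟨w, hw, residueHom_eq_zero_iff.1 ?_⟩
      rw [map_sub, ← h, differential_residueHom, sub_self]
    · rintro ⟨w, hw, h⟩
      refine ⟨residueHom ι I w, residueHom_mem_chains hw, ?_⟩
      rw [differential_residueHom, eq_comm, ← sub_eq_zero, ← map_sub]
      exact residueHom_eq_zero_iff.2 h
  have hK : ∀ (l : κ → K), residueHom ι I (∑ k, l k • z k) = ∑ k, l k • residueHom ι I (z k) := by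
    intro l
    rw [map_sum]
    refine Finset.sum_congr rfl fun k _ => ?_
    -- The residue map is only given as `R`-linear, so scalars from `K` pass through `R`.
    rw [← algebraMap_smul R, map_smul, algebraMap_smul]
  have hsum : ∀ (hz' : ∀ k, residueHom ι I (z k) ∈ cycles x (R ⧸ I) i) (l : κ → K),
      ∑ k, l k • homologyClass x i (residueHom ι I (z k)) (hz' k) =
        Submodule.Quotient.mk (∑ k, l k • (⟨residueHom ι I (z k), hz' k⟩ : cycles x (R ⧸ I) i)) := by
    intro hz' l
    exact (map_sum (((boundaries x (R ⧸ I) i).submoduleOf (cycles x (R ⧸ I) i)).mkQ.restrictScalars K)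
      (fun k => l k • (⟨residueHom ι I (z k), hz' k⟩ : cycles x (R ⧸ I) i)) Finset.univ).symm
  have hcoe : ∀ (hz' : ∀ k, residueHom ι I (z k) ∈ cycles x (R ⧸ I) i) (l : κ → K),
      ((∑ k, l k • (⟨residueHom ι I (z k), hz' k⟩ : cycles x (R ⧸ I) i) :
        cycles x (R ⧸ I) i) : Finset ι → R ⧸ I) = residueHom ι I (∑ k, l k • z k) := by
    intro hz' l
    rw [hK]
    exact map_sum ((cycles x (R ⧸ I) i).subtype.restrictScalars K)
      (fun k => l k • (⟨residueHom ι I (z k), hz' k⟩ : cycles x (R ⧸ I) i)) Finset.univ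
  change (∃ hz' : ∀ k, residueHom ι I (z k) ∈ cycles x (R ⧸ I) i,
    LinearIndependent K (fun k => homologyClass x i (residueHom ι I (z k)) (hz' k)) ∧
      Submodule.span K (Set.range fun k => homologyClass x i (residueHom ι I (z k)) (hz' k)) = ⊤) ↔ _
  have h1 : (∀ k, residueHom ι I (z k) ∈ cycles x (R ⧸ I) i) ↔
      ∀ k J, differential x R (z k) J ∈ I :=
    forall_congr' fun k => hcyc _ (hz k)
  rw [← h1, ← exists_prop]
  refine exists_congr fun hz' => and_congr ?_ ?_
  · rw [Fintype.linearIndependent_iff]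
    refine forall_congr' fun l => ?_
    rw [hsum hz', Submodule.Quotient.mk_eq_zero, Submodule.submoduleOf, Submodule.mem_comap,
      Submodule.subtype_apply, hcoe hz', hbd]
    exact ⟨fun h w hw hJ => h ⟨w, hw, hJ⟩, fun h ⟨w, hw, hJ⟩ => h w hw hJ⟩
  · rw [Submodule.eq_top_iff']
    constructor
    · intro h g hg hgI
      have hg' := (hcyc g hg).2 hgI
      obtain ⟨l, hl⟩ := (Submodule.mem_span_range_iff_exists_fun K).1
        (h (homologyClass x i (residueHom ι I g) hg'))
      refine ⟨l, ?_⟩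
      rw [← hbd, map_sub, ← hcoe hz']
      rw [hsum hz', eq_comm] at hl
      exact (Submodule.Quotient.eq ((boundaries x (R ⧸ I) i).submoduleOf (cycles x (R ⧸ I) i))).1 hl
    · intro h y
      obtain ⟨⟨g', hg'⟩, rfl⟩ := Submodule.Quotient.mk_surjective _ y
      obtain ⟨g, hg, rfl⟩ := exists_residueHom_eq hg'.1
      obtain ⟨l, hl⟩ := h g hg ((hcyc g hg).1 hg')
      rw [← hbd, map_sub, ← hcoe hz'] at hl
      refine (Submodule.mem_span_range_iff_exists_fun K).2 ⟨l, ?_⟩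
      rw [hsum hz', eq_comm]
      exact (Submodule.Quotient.eq ((boundaries x (R ⧸ I) i).submoduleOf (cycles x (R ⧸ I) i))).2 hl

end

end Koszul

/-! ### The monomial `K`-basis of the Koszul complex of the variables. -/

namespace Koszul

open MvPolynomial

section

variable {σ : Type*} [LinearOrder σ] {K : Type*} [Field K]

/-- The element `x^a e_J` of the Koszul complex of the variables. -/
noncomputable def cell (K : Type*) [Field K] (J : Finset σ) (a : σ →₀ ℕ) :
    Finset σ → MvPolynomial σ K :=
  Pi.single J (monomial a 1)

/-- The span over `K` of the elements `x^a e_J` for which `P J a` holds. -/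
def cellSpan (K : Type*) [Field K] (P : Finset σ → (σ →₀ ℕ) → Prop) :
    Submodule K (Finset σ → MvPolynomial σ K) where
  carrier := {f | ∀ J, ∀ a, coeff a (f J) ≠ 0 → P J a}
  add_mem' := fun {f g} hf hg J a h => by
    by_cases hfa : coeff a (f J) = 0
    · refine hg J a fun hga => h ?_
      simp [hfa, hga]
    · exact hf J a hfa
  zero_mem' := fun J a h => by simp at h
  smul_mem' := fun r f hf J a h => by
    refine hf J a fun hfa => h ?_
    simp [hfa]

theorem mem_cellSpan {P : Finset σ → (σ →₀ ℕ) → Prop} {f : Finset σ → MvPolynomial σ K} :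
    f ∈ cellSpan K P ↔ ∀ J, ∀ a, coeff a (f J) ≠ 0 → P J a :=
  Iff.rfl

theorem cell_mem_cellSpan {P : Finset σ → (σ →₀ ℕ) → Prop} {J : Finset σ} {a : σ →₀ ℕ}
    (h : P J a) : cell K J a ∈ cellSpan K P := by
  intro A b hb
  by_cases hA : A = J
  · subst hA
    rw [cell, Pi.single_eq_same, coeff_monomial] at hb
    have : a = b := by
      by_contra hab
      simp [hab] at hb
    exact this ▸ h
  · simp [cell, Pi.single_eq_of_ne hA] at hb

/-- The basis `x^a e_J` of the Koszul complex of the variables. -/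
noncomputable def cellBasis (σ K : Type*) [LinearOrder σ] [Fintype σ] [Field K] :
    Module.Basis (Σ _ : Finset σ, σ →₀ ℕ) K (Finset σ → MvPolynomial σ K) :=
  Pi.basis fun _ => basisMonomials σ K

/-- The `K`-linear map with prescribed values on the elements `x^a e_J`. -/
noncomputable def cellMap [Fintype σ] {M : Type*} [AddCommGroup M] [Module K M]
    (F : Finset σ → (σ →₀ ℕ) → M) : (Finset σ → MvPolynomial σ K) →ₗ[K] M :=
  (cellBasis σ K).constr K fun s => F s.1 s.2

theorem cellMap_cell [Fintype σ] {M : Type*} [AddCommGroup M] [Module K M]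
    (F : Finset σ → (σ →₀ ℕ) → M) (J : Finset σ) (a : σ →₀ ℕ) :
    cellMap F (cell K J a) = F J a := by
  have : cell K J a = cellBasis σ K ⟨J, a⟩ := by
    simp [cellBasis, Pi.basis_apply, cell]
  rw [this, cellMap, Module.Basis.constr_basis]

variable [Fintype σ]

theorem eq_sum_cell (f : Finset σ → MvPolynomial σ K) :
    f = ∑ J, ∑ a ∈ (f J).support, coeff a (f J) • cell K J a := by
  have h : ∀ J, ∑ a ∈ (f J).support, coeff a (f J) • cell K J a = Pi.single J (f J) := by
    intro J
    conv_rhs => rw [(f J).as_sum]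
    rw [← LinearMap.coe_single K (fun _ : Finset σ => MvPolynomial σ K), map_sum]
    refine Finset.sum_congr rfl fun a _ => ?_
    rw [cell, ← LinearMap.coe_single K (fun _ : Finset σ => MvPolynomial σ K), ← map_smul,
      smul_monomial, smul_eq_mul, mul_one]
  simp only [h]
  exact (Finset.univ_sum_single f).symm

theorem map_mem_of_cells {M : Type*} [AddCommGroup M] [Module K M]
    {P : Finset σ → (σ →₀ ℕ) → Prop} {L : (Finset σ → MvPolynomial σ K) →ₗ[K] M}
    {N : Submodule K M} (h : ∀ J a, P J a → L (cell K J a) ∈ N)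
    {f : Finset σ → MvPolynomial σ K} (hf : f ∈ cellSpan K P) : L f ∈ N := by
  rw [eq_sum_cell f]
  simp only [map_sum, map_smul]
  exact N.sum_mem fun J _ => N.sum_mem fun a ha =>
    N.smul_mem _ (h J a (hf J a (mem_support_iff.1 ha)))

theorem map_eq_of_cells {M : Type*} [AddCommGroup M] [Module K M]
    {P : Finset σ → (σ →₀ ℕ) → Prop} {L L' : (Finset σ → MvPolynomial σ K) →ₗ[K] M}
    (h : ∀ J a, P J a → L (cell K J a) = L' (cell K J a))
    {f : Finset σ → MvPolynomial σ K} (hf : f ∈ cellSpan K P) : L f = L' f := by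
  rw [← sub_eq_zero, ← LinearMap.sub_apply, ← Submodule.mem_bot K]
  refine map_mem_of_cells (fun J a hJ => ?_) hf
  simp [h J a hJ]

theorem linearMap_ext_cells {M : Type*} [AddCommGroup M] [Module K M]
    {L L' : (Finset σ → MvPolynomial σ K) →ₗ[K] M}
    (h : ∀ J a, L (cell K J a) = L' (cell K J a)) : L = L' :=
  LinearMap.ext fun _ => map_eq_of_cells (P := fun _ _ => True) (fun J a _ => h J a)
    fun _ _ _ => trivial

/-- Puts homological degree in the same form as membership in a monomial ideal and bounds on the
multidegree, so that all of them can be checked cell by cell. -/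
theorem mem_chains_iff_mem_cellSpan {i : ℕ} {f : Finset σ → MvPolynomial σ K} :
    f ∈ chains σ (MvPolynomial σ K) (MvPolynomial σ K) i ↔
      f ∈ cellSpan K (fun J _ => J.card = i) := by
  rw [mem_chains, mem_cellSpan]
  refine forall_congr' fun J => ⟨fun h a ha => ?_, fun h hJ => ?_⟩
  · by_contra hJ
    simp [h hJ] at ha
  · ext a
    by_contra ha
    exact hJ (h a ha)

/-- The differential of the Koszul complex of the variables, as a `K`-linear map. -/
noncomputable def diff (σ K : Type*) [LinearOrder σ] [Fintype σ] [Field K] :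
    (Finset σ → MvPolynomial σ K) →ₗ[K] (Finset σ → MvPolynomial σ K) where
  toFun := differential (fun p : σ => (X p : MvPolynomial σ K)) (MvPolynomial σ K)
  map_add' := map_add _
  map_smul' r f := by
    rw [← algebraMap_smul (MvPolynomial σ K) r f, map_smul, algebraMap_smul, RingHom.id_apply]

theorem diff_apply (f : Finset σ → MvPolynomial σ K) : diff σ K f =
    differential (fun p : σ => (X p : MvPolynomial σ K)) (MvPolynomial σ K) f := rfl

theorem diff_diff (f : Finset σ → MvPolynomial σ K) : diff σ K (diff σ K f) = 0 := by
  rw [diff_apply, diff_apply]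
  exact differential_differential _ f

theorem diff_cell (J : Finset σ) (a : σ →₀ ℕ) :
    diff σ K (cell K J a) =
      ∑ k ∈ J, sign K J k • cell K (J.erase k) (a + Finsupp.single k 1) := by
  rw [diff_apply]
  nth_rewrite 1 [cell]
  rw [differential_single]
  refine Finset.sum_congr rfl fun k _ => ?_
  have h1 : sign (MvPolynomial σ K) J k = C (sign K J k) := by simp [sign]
  have h2 : (sign (MvPolynomial σ K) J k * X k) • monomial a (1 : K) =
      sign K J k • monomial (a + Finsupp.single k 1) (1 : K) := by
    rw [h1, smul_eq_mul, mul_assoc, ← smul_eq_C_mul, X, monomial_mul, one_mul, add_comm]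
  rw [h2, cell]
  exact Pi.single_smul _ _ _

theorem diff_mem_cellSpan {P Q : Finset σ → (σ →₀ ℕ) → Prop}
    (h : ∀ J a, P J a → ∀ k ∈ J, Q (J.erase k) (a + Finsupp.single k 1))
    {f : Finset σ → MvPolynomial σ K} (hf : f ∈ cellSpan K P) : diff σ K f ∈ cellSpan K Q := by
  refine map_mem_of_cells (fun J a hJ => ?_) hf
  rw [diff_cell]
  exact Submodule.sum_mem _ fun k hk =>
    Submodule.smul_mem _ _ (cell_mem_cellSpan (h J a hJ k hk))

theorem diff_mem_chains {i : ℕ} {f : Finset σ → MvPolynomial σ K}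
    (hf : f ∈ cellSpan K (fun J _ => J.card = i + 1)) :
    diff σ K f ∈ cellSpan K (fun J _ => J.card = i) :=
  diff_mem_cellSpan (fun J _ hJ k hk => by rw [Finset.card_erase_of_mem hk, hJ]; rfl) hf

theorem sign_mul_self (J : Finset σ) (k : σ) : sign K J k * sign K J k = 1 := by
  rw [sign, ← mul_pow]; simp

end

end Koszul

/-! ### Free indices and the homotopies that remove them. -/

namespace Koszul

open MvPolynomial

section

variable {σ : Type*} [LinearOrder σ] {K : Type*} [Field K]

/-- The index `p` is free for `x^a e_J`, with respect to a relation `r` on the indices, if it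
occurs in the multidegree of `x^a e_J` and if moreover either it occurs there with multiplicity at
least two or some `x_q` with `r q p` does not divide `x^a`. -/
def IsFree (r : σ → σ → Prop) (p : σ) (J : Finset σ) (a : σ →₀ ℕ) : Prop :=
  (p ∈ J ∨ a p ≠ 0) ∧ (2 ≤ a p + (if p ∈ J then 1 else 0) ∨ ∃ q, r q p ∧ a q = 0)

/-- The differential keeps the multidegree and only enlarges the monomial, so it can fill a gap but
not create one. Hence cells for which `p` is not free span a subcomplex. -/
theorem IsFree.of_step {r : σ → σ → Prop} {p : σ} {J : Finset σ} {a : σ →₀ ℕ} {k : σ} (hk : k ∈ J)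
    (h : IsFree r p (J.erase k) (a + Finsupp.single k 1)) : IsFree r p J a := by
  obtain ⟨h1, h2⟩ := h
  constructor
  · by_cases hp : p = k
    · exact Or.inl (hp ▸ hk)
    · simpa [hp, Finsupp.single_apply, Ne.symm hp] using h1
  · refine h2.imp (fun h => ?_) ?_
    · by_cases hp : p = k
      · subst hp; simpa [hk] using h
      · simpa [hp, Finsupp.single_apply, Ne.symm hp] using h
    · rintro ⟨q, hq, hq'⟩
      simp only [Finsupp.add_apply, Nat.add_eq_zero_iff] at hq'
      exact ⟨q, hq, hq'.1⟩

theorem isFree_toggle_self {r : σ → σ → Prop} (hr : ∀ p, ¬ r p p) {p : σ} {J : Finset σ}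
    (hp : p ∉ J) (a : σ →₀ ℕ) :
    IsFree r p (insert p J) a ↔ IsFree r p J (a + Finsupp.single p 1) := by
  refine and_congr (by simp) (or_congr (by simp [hp]) (exists_congr fun q => and_congr_right ?_))
  intro hq
  have : q ≠ p := fun h => hr p (h ▸ hq)
  simp [this.symm]

/-- Moving the free index `p` between exterior and polynomial part could only matter for `q` if `p`
were the gap below `q`. Then `p` has multiplicity one, so its freeness comes from a gap below `p`,
which by transitivity also lies below `q`. This lets the indices be treated one after another. -/
theorem isFree_toggle {r : σ → σ → Prop} (hr : ∀ p, ¬ r p p)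
    (hr' : ∀ p q s, r p q → r q s → r p s) {p : σ} {J : Finset σ}
    (hp : p ∉ J) (a : σ →₀ ℕ) (h : IsFree r p (insert p J) a) (q : σ) :
    IsFree r q (insert p J) a ↔ IsFree r q J (a + Finsupp.single p 1) := by
  by_cases hq : q = p
  · rw [hq]; exact isFree_toggle_self hr hp a
  refine and_congr (by simp [hq]) ?_
  have h1 : (if q ∈ insert p J then 1 else 0) = if q ∈ J then 1 else 0 := by simp [hq]
  have h2 : (a + Finsupp.single p 1 : σ →₀ ℕ) q = a q := by simp [hq]
  rw [h1, h2]
  constructor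
  · rintro (h3 | ⟨s, hs, hs'⟩)
    · exact Or.inl h3
    · by_cases hsp : s = p
      · subst hsp
        obtain ⟨_, h4 | ⟨t, ht, ht'⟩⟩ := h
        · simp [hs'] at h4
        · have : t ≠ s := fun h => hr s (h ▸ ht)
          exact Or.inr ⟨t, hr' _ _ _ ht hs, by simp [ht', this.symm]⟩
      · exact Or.inr ⟨s, hs, by simp [hs', Ne.symm hsp]⟩
  · refine Or.imp_right ?_
    rintro ⟨s, hs, hs'⟩
    simp only [Finsupp.add_apply, Nat.add_eq_zero_iff] at hs'
    exact ⟨s, hs, hs'.1⟩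

variable [Fintype σ]

open scoped Classical in
/-- The homotopy that sends `x^a e_J` to `± (x^a / x_p) e_{J ∪ {p}}` if `p` is free for `x^a e_J`
and not in `J`, and to zero otherwise. -/
noncomputable def toggleHomotopy (K : Type*) [Field K] (r : σ → σ → Prop) (p : σ) :
    (Finset σ → MvPolynomial σ K) →ₗ[K] (Finset σ → MvPolynomial σ K) :=
  cellMap fun J a => if p ∉ J ∧ IsFree r p J a then
    sign K J p • cell K (insert p J) (a - Finsupp.single p 1) else 0

theorem toggleHomotopy_cell_of_not {r : σ → σ → Prop} {p : σ} {J : Finset σ} {a : σ →₀ ℕ}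
    (h : ¬ (p ∉ J ∧ IsFree r p J a)) : toggleHomotopy K r p (cell K J a) = 0 := by
  rw [toggleHomotopy, cellMap_cell, if_neg h]

theorem toggleHomotopy_cell {r : σ → σ → Prop} {p : σ} {J : Finset σ} {a : σ →₀ ℕ}
    (hp : p ∉ J) (h : IsFree r p J (a + Finsupp.single p 1)) :
    toggleHomotopy K r p (cell K J (a + Finsupp.single p 1)) =
      sign K J p • cell K (insert p J) a := by
  rw [toggleHomotopy, cellMap_cell, if_pos ⟨hp, h⟩, add_tsub_cancel_right]

theorem IsFree.exists_eq_add {r : σ → σ → Prop} {p : σ} {J : Finset σ} {a : σ →₀ ℕ}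
    (h : IsFree r p J a) (hp : p ∉ J) : ∃ b, a = b + Finsupp.single p 1 := by
  have : a p ≠ 0 := h.1.resolve_left hp
  refine ⟨a - Finsupp.single p 1, (tsub_add_cancel_of_le ?_).symm⟩
  rw [Finsupp.single_le_iff]
  omega

theorem toggleHomotopy_mem_cellSpan {r : σ → σ → Prop} {p : σ}
    {P Q : Finset σ → (σ →₀ ℕ) → Prop}
    (h : ∀ J a, p ∉ J → IsFree r p J (a + Finsupp.single p 1) → P J (a + Finsupp.single p 1) →
      Q (insert p J) a)
    {f : Finset σ → MvPolynomial σ K} (hf : f ∈ cellSpan K P) :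
    toggleHomotopy K r p f ∈ cellSpan K Q := by
  refine map_mem_of_cells (fun J a hJ => ?_) hf
  by_cases hp : p ∉ J ∧ IsFree r p J a
  · obtain ⟨b, rfl⟩ := hp.2.exists_eq_add hp.1
    rw [toggleHomotopy_cell hp.1 hp.2]
    exact Submodule.smul_mem _ _ (cell_mem_cellSpan (h J b hp.1 hp.2 hJ))
  · rw [toggleHomotopy_cell_of_not hp]
    exact Submodule.zero_mem _

theorem sign_insert_self (J : Finset σ) (p : σ) :
    sign K (insert p J) p = sign K J p := by
  rw [sign, sign, Finset.filter_insert, if_neg (lt_irrefl p)]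

/-- Exterior multiplication by `e_p` anticommutes with contraction along `e_k` for `k ≠ p`. -/
theorem sign_toggle {J : Finset σ} {p k : σ} (hp : p ∉ J) (hk : k ∈ J) :
    sign K J p * sign K (insert p J) k + sign K J k * sign K (J.erase k) p = 0 := by
  have hpk : p ≠ k := fun h => hp (h ▸ hk)
  have key : sign K (insert p J) k * sign K (J.erase k) p = -(sign K J p * sign K J k) := by
    have h1 : sign K ((insert p J).erase k) p = sign K (J.erase k) p := by
      rw [Finset.erase_insert_of_ne hpk, sign_insert_self]
    have h2 : (insert p J).erase p = J := Finset.erase_insert hp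
    rcases lt_or_gt_of_ne hpk with h | h
    · have := sign_erase_mul (R := K) (insert p J) (Finset.mem_insert_self p J) h
      rw [h1, h2, sign_insert_self] at this
      rw [this, neg_neg]
    · have := sign_erase_mul (R := K) (insert p J) (Finset.mem_insert_of_mem hk) h
      rw [h1, h2, sign_insert_self] at this
      exact this
  have h3 := sign_mul_self (K := K) J k
  have h4 := sign_mul_self (K := K) (insert p J) k
  linear_combination sign K (insert p J) k * sign K J k * key
    - sign K J k * sign K (J.erase k) p * h4 - sign K J p * sign K (insert p J) k * h3

/-- The toggle contracts the quotient by the subcomplex of cells for which `p` is not free. -/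
theorem toggle_mem_cellSpan_not_free {r : σ → σ → Prop} (hr : ∀ p, ¬ r p p) (p : σ) (f : Finset σ → MvPolynomial σ K) :
    f - diff σ K (toggleHomotopy K r p f) - toggleHomotopy K r p (diff σ K f) ∈
      cellSpan K (fun J a => ¬ IsFree r p J a) := by
  set L : (Finset σ → MvPolynomial σ K) →ₗ[K] (Finset σ → MvPolynomial σ K) :=
    LinearMap.id - diff σ K ∘ₗ toggleHomotopy K r p - toggleHomotopy K r p ∘ₗ diff σ K with hL
  change L f ∈ _
  refine map_mem_of_cells (P := fun _ _ => True) (fun J a _ => ?_) fun _ _ _ => trivial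
  simp only [hL, LinearMap.sub_apply, LinearMap.comp_apply, LinearMap.id_apply]
  by_cases hfree : IsFree r p J a
  · by_cases hp : p ∈ J
    -- Only the face that loses `p` can be toggled, and toggling returns the original cell.
    · rw [toggleHomotopy_cell_of_not fun h => h.1 hp, map_zero, sub_zero, diff_cell, map_sum,
        Finset.sum_eq_single_of_mem p hp]
      · have h1 : insert p (J.erase p) = J := Finset.insert_erase hp
        have h2 := (isFree_toggle_self hr (Finset.notMem_erase p J) a).1 (by rwa [h1])
        rw [map_smul, toggleHomotopy_cell (Finset.notMem_erase p J) h2, h1, smul_smul]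
        have h3 : sign K (J.erase p) p = sign K J p := by
          rw [← sign_insert_self (J.erase p), h1]
        rw [h3, sign_mul_self, one_smul, sub_self]
        exact Submodule.zero_mem _
      · intro k hk hkp
        rw [map_smul, toggleHomotopy_cell_of_not fun h => h.1 (Finset.mem_erase.2 ⟨hkp.symm, hp⟩),
          smul_zero]
    · obtain ⟨b, rfl⟩ := hfree.exists_eq_add hp
      rw [toggleHomotopy_cell hp hfree, map_smul, diff_cell, diff_cell, Finset.sum_insert hp,
        sign_insert_self, Finset.erase_insert hp, smul_add, smul_smul, sign_mul_self, one_smul,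
        map_sum, Finset.smul_sum, sub_add_eq_sub_sub, sub_self, zero_sub, ← neg_add', neg_mem_iff,
        ← Finset.sum_add_distrib]
      refine Submodule.sum_mem _ fun k hk => ?_
      have hpk : p ≠ k := fun h => hp (h ▸ hk)
      have hp' : p ∉ J.erase k := fun h => hp (Finset.mem_of_mem_erase h)
      rw [map_smul, smul_smul, Finset.erase_insert_of_ne hpk, add_right_comm]
      -- Contributions of a face cancel by the sign rule if `p` is still free there. Otherwise one
      -- term survives, and it is a cell for which `p` is not free.
      by_cases h : IsFree r p (J.erase k) (b + Finsupp.single k 1 + Finsupp.single p 1)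
      · rw [toggleHomotopy_cell hp' h, smul_smul, ← add_smul, sign_toggle hp hk, zero_smul]
        exact Submodule.zero_mem _
      · rw [toggleHomotopy_cell_of_not fun h' => h h'.2, smul_zero, add_zero]
        refine Submodule.smul_mem _ _ (cell_mem_cellSpan fun h' => h ?_)
        exact (isFree_toggle_self hr hp' _).1 h'
  · rw [toggleHomotopy_cell_of_not fun h => hfree h.2, map_zero, sub_zero, diff_cell, map_sum,
      Finset.sum_eq_zero, sub_zero]
    · exact cell_mem_cellSpan hfree
    · intro k hk
      rw [map_smul, toggleHomotopy_cell_of_not fun h => hfree (h.2.of_step hk), smul_zero]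

/-- The ideal-theoretic condition on exponents under which all toggles respect the ideal. -/
def ToggleClosed (r : σ → σ → Prop) (P : (σ →₀ ℕ) → Prop) : Prop :=
  (∀ a k, P a → P (a + Finsupp.single k 1)) ∧
    ∀ a p, P (a + Finsupp.single p 1) → (a p ≠ 0 ∨ ∃ q, r q p ∧ a q = 0) → P a

theorem diff_mem_not_free {r : σ → σ → Prop} {A : Set σ} {f : Finset σ → MvPolynomial σ K}
    (hf : f ∈ cellSpan K (fun J a => ∀ q ∈ A, ¬ IsFree r q J a)) :
    diff σ K f ∈ cellSpan K (fun J a => ∀ q ∈ A, ¬ IsFree r q J a) :=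
  diff_mem_cellSpan (fun _ _ h _ hk q hq h' => h q hq (h'.of_step hk)) hf

/-- There is a homotopy from the identity to a map into the span of those `x^a e_J` that have no
free index. -/
theorem exists_homotopy_no_free {r : σ → σ → Prop} (hr : ∀ p, ¬ r p p)
    (hr' : ∀ p q s, r p q → r q s → r p s) :
    ∃ H : (Finset σ → MvPolynomial σ K) →ₗ[K] (Finset σ → MvPolynomial σ K),
      (∀ f, f - diff σ K (H f) - H (diff σ K f) ∈ cellSpan K (fun J a => ∀ p, ¬ IsFree r p J a)) ∧
      (∀ f ∈ cellSpan K (fun J a => ∀ p, ¬ IsFree r p J a), H f = 0) ∧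
      (∀ i, ∀ f ∈ cellSpan K (fun J _ => J.card = i),
        H f ∈ cellSpan K (fun J _ => J.card = i + 1)) ∧
      (∀ P, ToggleClosed r P → ∀ f ∈ cellSpan K (fun _ a => P a),
        H f ∈ cellSpan K (fun _ a => P a)) := by
  suffices h : ∀ A : Finset σ,
      ∃ H : (Finset σ → MvPolynomial σ K) →ₗ[K] (Finset σ → MvPolynomial σ K),
      (∀ f, f - diff σ K (H f) - H (diff σ K f) ∈
        cellSpan K (fun J a => ∀ p ∈ (A : Set σ), ¬ IsFree r p J a)) ∧
      (∀ f ∈ cellSpan K (fun J a => ∀ p, ¬ IsFree r p J a), H f = 0) ∧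
      (∀ i, ∀ f ∈ cellSpan K (fun J _ => J.card = i),
        H f ∈ cellSpan K (fun J _ => J.card = i + 1)) ∧
      (∀ P, ToggleClosed r P → ∀ f ∈ cellSpan K (fun _ a => P a),
        H f ∈ cellSpan K (fun _ a => P a)) by
    simpa using h Finset.univ
  intro A
  induction A using Finset.induction_on with
  | empty => exact ⟨0, by simp [mem_cellSpan]⟩
  | insert p A hpA ih =>
    obtain ⟨H, h1, h2, h3, h4⟩ := ih
    have hdiff : ∀ f ∈ cellSpan K (fun J a => ∀ p, ¬ IsFree r p J a),
        diff σ K f ∈ cellSpan K (fun J a => ∀ p, ¬ IsFree r p J a) := by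
      intro f hf
      simpa using diff_mem_not_free (r := r) (A := Set.univ) (by simpa using hf)
    set t := toggleHomotopy K r p with ht
    have ht2 : ∀ f ∈ cellSpan K (fun J a => ∀ p, ¬ IsFree r p J a), t f = 0 := by
      intro f hf
      rw [← Submodule.mem_bot K]
      refine map_mem_of_cells (fun J a hJ => ?_) hf
      rw [ht, toggleHomotopy_cell_of_not fun h => hJ p h.2]
      exact Submodule.zero_mem _
    have ht3 : ∀ i, ∀ f ∈ cellSpan K (fun J _ => J.card = i),
        t f ∈ cellSpan K (fun J _ => J.card = i + 1) := by
      intro i f hf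
      refine toggleHomotopy_mem_cellSpan (fun J a hp _ hJ => ?_) hf
      rw [Finset.card_insert_of_notMem hp, hJ]
    have ht4 : ∀ P, ToggleClosed r P → ∀ f ∈ cellSpan K (fun _ a => P a),
        t f ∈ cellSpan K (fun _ a => P a) := by
      intro P hP f hf
      refine toggleHomotopy_mem_cellSpan (fun J a hp h h' => hP.2 a p h' ?_) hf
      refine h.2.imp (fun h5 => ?_) ?_
      · simp only [Finsupp.add_apply, Finsupp.single_eq_same, hp, if_false] at h5
        omega
      · rintro ⟨q, hq, hq'⟩
        simp only [Finsupp.add_apply, Nat.add_eq_zero_iff] at hq'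
        exact ⟨q, hq, hq'.1⟩
    have htA : ∀ f ∈ cellSpan K (fun J a => ∀ q ∈ (A : Set σ), ¬ IsFree r q J a),
        t f ∈ cellSpan K (fun J a => ∀ q ∈ (A : Set σ), ¬ IsFree r q J a) := by
      intro f hf
      refine toggleHomotopy_mem_cellSpan (fun J a hp h hJ q hq h' => hJ q hq ?_) hf
      exact (isFree_toggle hr hr' hp a ((isFree_toggle_self hr hp a).2 h) q).1 h'
    have hP4 : ∀ P, ToggleClosed r P → ∀ f ∈ cellSpan K (fun _ a => P a),
        diff σ K f ∈ cellSpan K (fun _ a => P a) := fun P hP f hf =>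
      diff_mem_cellSpan (fun _ a ha k _ => hP.1 a k ha) hf
    set φ : (Finset σ → MvPolynomial σ K) →ₗ[K] (Finset σ → MvPolynomial σ K) :=
      LinearMap.id - diff σ K ∘ₗ H - H ∘ₗ diff σ K with hφ
    have hφa : ∀ f, φ f = f - diff σ K (H f) - H (diff σ K f) := fun f => rfl
    have hφd : ∀ f, φ (diff σ K f) = diff σ K (φ f) := by
      intro f
      simp only [hφa, map_sub, diff_diff, map_zero, sub_zero]
    -- With this homotopy the new projection is the one for `p` applied after `φ`, since `φ` is a
    -- chain map.
    refine ⟨H + t ∘ₗ φ, fun f => ?_, fun f hf => ?_, fun i f hf => ?_, fun P hP f hf => ?_⟩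
    · have h5 : f - diff σ K ((H + t ∘ₗ φ) f) - (H + t ∘ₗ φ) (diff σ K f) =
          φ f - diff σ K (t (φ f)) - t (diff σ K (φ f)) := by
        simp only [LinearMap.add_apply, LinearMap.comp_apply, hφd, map_add, hφa f]
        abel
      have h6 : φ f - diff σ K (t (φ f)) - t (diff σ K (φ f)) ∈
          cellSpan K (fun J a => ∀ q ∈ (A : Set σ), ¬ IsFree r q J a) :=
        Submodule.sub_mem _ (Submodule.sub_mem _ (h1 f) (diff_mem_not_free (htA _ (h1 f))))
          (htA _ (diff_mem_not_free (h1 f)))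
      have h7 := toggle_mem_cellSpan_not_free hr p (φ f)
      rw [h5]
      intro J a ha q hq
      rcases Finset.mem_insert.1 hq with rfl | hq
      · exact h7 J a ha
      · exact h6 J a ha q hq
    · have h5 : φ f = f := by
        rw [hφa, h2 f hf, h2 _ (hdiff f hf), map_zero, sub_zero, sub_zero]
      rw [LinearMap.add_apply, LinearMap.comp_apply, h5, h2 f hf, ht2 f hf, add_zero]
    -- Degree zero is separate: there the differential vanishes, and no degree `i - 1` is available.
    · have h5 : H (diff σ K f) ∈ cellSpan K (fun J _ => J.card = i) := by
        cases i with
        | zero =>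
          have : diff σ K f = 0 := by
            rw [← Submodule.mem_bot K]
            refine map_mem_of_cells (fun J a hJ => ?_) hf
            rw [Finset.card_eq_zero.1 hJ, diff_cell, Finset.sum_empty]
            exact Submodule.zero_mem _
          rw [this, map_zero]
          exact Submodule.zero_mem _
        | succ j => exact h3 j _ (diff_mem_chains hf)
      exact Submodule.add_mem _ (h3 i f hf) (ht3 i _ (Submodule.sub_mem _
        (Submodule.sub_mem _ hf (diff_mem_chains (h3 i f hf))) h5))
    · exact Submodule.add_mem _ (h4 P hP f hf) (ht4 P hP _ (Submodule.sub_mem _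
        (Submodule.sub_mem _ hf (hP4 P hP _ (h4 P hP f hf))) (h4 P hP _ (hP4 P hP f hf))))

end

end Koszul

/-! ### Polarization as a bijection onto the cells without free indices. -/

namespace Polarization

open MvPolynomial Koszul

section

variable {K : Type*} [Field K] {n : ℕ} {c : Fin n → ℕ}

/-- The variable `q` precedes `p` in the same row. -/
def Precedes (q p : PolVar c) : Prop :=
  (ofLex q).1 = (ofLex p).1 ∧ ((ofLex q).2 : ℕ) < (ofLex p).2

theorem precedes_irrefl (p : PolVar c) : ¬ Precedes p p := fun h => lt_irrefl _ h.2

theorem Precedes.trans {p q s : PolVar c} (h : Precedes p q) (h' : Precedes q s) :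
    Precedes p s :=
  ⟨h.1.trans h'.1, h.2.trans h'.2⟩

theorem polVar_ext {p q : PolVar c} (h1 : (ofLex p).1 = (ofLex q).1)
    (h2 : ((ofLex p).2 : ℕ) = (ofLex q).2) : p = q := by
  obtain ⟨i, j⟩ := p
  obtain ⟨i', j'⟩ := q
  change i = i' at h1
  subst h1
  obtain rfl : j = j' := Fin.ext h2
  rfl

theorem polVar_lt_iff {p q : PolVar c} (h : (ofLex p).1 ≠ (ofLex q).1) :
    p < q ↔ (ofLex p).1 < (ofLex q).1 := by
  rw [Sigma.Lex.lt_def]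
  exact ⟨fun h' => h'.resolve_right fun ⟨h'', _⟩ => h h'', Or.inl⟩

/-- The exponent vector of the polarization of `x^a`. -/
noncomputable def polExp (c : Fin n → ℕ) (a : Fin n →₀ ℕ) : PolVar c →₀ ℕ :=
  Finsupp.equivFunOnFinite.symm fun p => if ((ofLex p).2 : ℕ) < a (ofLex p).1 then 1 else 0

theorem polExp_apply (a : Fin n →₀ ℕ) (p : PolVar c) :
    polExp c a p = if ((ofLex p).2 : ℕ) < a (ofLex p).1 then 1 else 0 :=
  rfl

theorem polMonomial_eq (a : Fin n →₀ ℕ) :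
    polMonomial K c a = monomial (polExp c a) 1 := by
  rw [monomial_eq, Finsupp.prod_fintype _ _ fun _ => pow_zero _, C_1, one_mul, polMonomial,
    Finset.prod_filter]
  refine Finset.prod_congr rfl fun p _ => ?_
  rw [polExp_apply]
  split_ifs <;> simp

theorem polExp_le_iff {a b : Fin n →₀ ℕ} (ha : ∀ i, a i ≤ c i) :
    polExp c a ≤ polExp c b ↔ a ≤ b := by
  constructor
  · intro h i
    by_contra! hi
    -- Counting from `0`, this is the variable `x_{i, b_i + 1}`: it divides the polarization of
    -- `x^a` but not that of `x^b`.
    have := h (toLex ⟨i, ⟨b i, hi.trans_le (ha i)⟩⟩)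
    simp [polExp_apply, hi] at this
  · intro h p
    have := h (ofLex p).1
    simp only [polExp_apply]
    split_ifs <;> omega

theorem mem_polIndex {a : Fin n →₀ ℕ} {J : Finset (Fin n)} {p : PolVar c} :
    p ∈ polIndex c a J ↔ (ofLex p).1 ∈ J ∧ ((ofLex p).2 : ℕ) = a (ofLex p).1 := by
  simp [polIndex]

theorem multideg_le_iff {a : Fin n →₀ ℕ} {J : Finset (Fin n)} :
    multideg a J ≤ c ↔ (∀ i, a i ≤ c i) ∧ ∀ i ∈ J, a i < c i := by
  constructor
  · intro h
    refine ⟨fun i => (Nat.le_add_right _ _).trans (h i), fun i hi => ?_⟩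
    have := h i
    rw [multideg, if_pos hi] at this
    exact this
  · rintro ⟨h1, h2⟩ i
    rw [multideg]
    split_ifs with hi
    · exact h2 i hi
    · exact h1 i

theorem exists_mem_polIndex {a : Fin n →₀ ℕ} {J : Finset (Fin n)} (h : ∀ i ∈ J, a i < c i)
    {i : Fin n} (hi : i ∈ J) : ∃ p ∈ polIndex c a J, (ofLex p).1 = i :=
  ⟨toLex ⟨i, ⟨a i, h i hi⟩⟩, mem_polIndex.2 ⟨hi, rfl⟩, rfl⟩

theorem eq_of_mem_polIndex {a : Fin n →₀ ℕ} {J : Finset (Fin n)} {p q : PolVar c}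
    (hp : p ∈ polIndex c a J) (hq : q ∈ polIndex c a J) (h : (ofLex p).1 = (ofLex q).1) : p = q :=
  polVar_ext h (by rw [(mem_polIndex.1 hp).2, (mem_polIndex.1 hq).2, h])

theorem polIndex_card {a : Fin n →₀ ℕ} {J : Finset (Fin n)} (h : ∀ i ∈ J, a i < c i) :
    (polIndex c a J).card = J.card :=
  Finset.card_bij (fun p _ => (ofLex p).1) (fun _ hp => (mem_polIndex.1 hp).1)
    (fun _ hp _ hq => eq_of_mem_polIndex hp hq)
    fun _ hi => (exists_mem_polIndex h hi).imp fun _ hp => ⟨hp.1, hp.2⟩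

/-- The set has one index per row in `J`, so projecting to rows preserves the lexicographic order.
-/
theorem sign_polIndex {a : Fin n →₀ ℕ} {J : Finset (Fin n)} (h : ∀ i ∈ J, a i < c i)
    {p : PolVar c} (hp : p ∈ polIndex c a J) :
    sign K (polIndex c a J) p = sign K J (ofLex p).1 := by
  have key : ∀ q ∈ polIndex c a J, (q < p ↔ (ofLex q).1 < (ofLex p).1) := by
    intro q hq
    by_cases hqp : (ofLex q).1 = (ofLex p).1
    · rw [eq_of_mem_polIndex hq hp hqp]; simp
    · exact polVar_lt_iff hqp
  rw [sign, sign]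
  congr 1
  refine Finset.card_bij (fun q _ => (ofLex q).1) ?_ ?_ ?_
  · intro q hq
    rw [Finset.mem_filter] at hq ⊢
    exact ⟨(mem_polIndex.1 hq.1).1, (key q hq.1).1 hq.2⟩
  · intro q hq q' hq'
    exact eq_of_mem_polIndex (Finset.mem_filter.1 hq).1 (Finset.mem_filter.1 hq').1
  · intro i hi
    rw [Finset.mem_filter] at hi
    obtain ⟨q, hq, rfl⟩ := exists_mem_polIndex h hi.1
    exact ⟨q, Finset.mem_filter.2 ⟨hq, (key q hq).2 hi.2⟩, rfl⟩

theorem polExp_add_single {a : Fin n →₀ ℕ} {J : Finset (Fin n)} {p : PolVar c}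
    (hp : p ∈ polIndex c a J) :
    polExp c (a + Finsupp.single (ofLex p).1 1) = polExp c a + Finsupp.single p 1 := by
  have hp2 := (mem_polIndex.1 hp).2
  ext q
  rw [Finsupp.add_apply, polExp_apply, polExp_apply, Finsupp.add_apply, Finsupp.single_apply,
    Finsupp.single_apply]
  by_cases hqp : p = q
  · subst hqp; simp [hp2]
  · rw [if_neg hqp]
    by_cases hrow : (ofLex p).1 = (ofLex q).1
    · have hne : ((ofLex q).2 : ℕ) ≠ a (ofLex q).1 := fun h =>
        hqp (polVar_ext hrow (by rw [hp2, h, hrow]))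
      rw [if_pos hrow]
      split_ifs <;> omega
    · simp [hrow]

theorem polIndex_erase {a : Fin n →₀ ℕ} {J : Finset (Fin n)} {p : PolVar c}
    (hp : p ∈ polIndex c a J) :
    polIndex c (a + Finsupp.single (ofLex p).1 1) (J.erase (ofLex p).1) =
      (polIndex c a J).erase p := by
  ext q
  rw [Finset.mem_erase, mem_polIndex, mem_polIndex, Finset.mem_erase, Finsupp.add_apply,
    Finsupp.single_apply]
  by_cases hrow : (ofLex p).1 = (ofLex q).1
  · refine ⟨fun h => (h.1.1 hrow.symm).elim, fun h => (h.1 ?_).elim⟩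
    exact eq_of_mem_polIndex (mem_polIndex.2 h.2) hp hrow.symm
  · have : q ≠ p := fun h => hrow (h ▸ rfl)
    simp [hrow, this, Ne.symm hrow]

theorem multideg_erase {a : Fin n →₀ ℕ} {J : Finset (Fin n)} {k : Fin n} (hk : k ∈ J) :
    multideg (a + Finsupp.single k 1) (J.erase k) = multideg a J := by
  ext i
  by_cases h : i = k
  · subst h; simp [multideg, hk]
  · simp [multideg, h]

theorem polExp_polIndex_injective {a a' : Fin n →₀ ℕ} {J J' : Finset (Fin n)}
    (h : multideg a J ≤ c) (h' : multideg a' J' ≤ c) (hE : polExp c a = polExp c a')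
    (hJ : polIndex c a J = polIndex c a' J') : a = a' ∧ J = J' := by
  rw [multideg_le_iff] at h h'
  have haa : a = a' :=
    le_antisymm ((polExp_le_iff h.1).1 hE.le) ((polExp_le_iff h'.1).1 hE.ge)
  refine ⟨haa, ?_⟩
  ext i
  constructor
  · intro hi
    obtain ⟨p, hp, rfl⟩ := exists_mem_polIndex h.2 hi
    exact (mem_polIndex.1 (hJ ▸ hp)).1
  · intro hi
    obtain ⟨p, hp, rfl⟩ := exists_mem_polIndex h'.2 hi
    exact (mem_polIndex.1 (hJ ▸ hp)).1

/-- In row `i` the variables fill the first `a_i` places and the exterior factor, if any, takes the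
next one: no repetition and no gap. -/
theorem not_isFree_polIndex (a : Fin n →₀ ℕ) (J : Finset (Fin n)) (p : PolVar c) :
    ¬ IsFree Precedes p (polIndex c a J) (polExp c a) := by
  rintro ⟨h1, h2⟩
  simp only [mem_polIndex, polExp_apply] at h1 h2
  rcases h2 with h2 | ⟨q, ⟨hq, hq'⟩, h2⟩
  · split_ifs at h2 <;> omega
  · simp only [hq] at h2
    split_ifs at h1 h2 <;> omega

theorem exists_bound_of_downward_closed {m : ℕ} (P : Fin m → Prop)
    (h : ∀ j k : Fin m, (j : ℕ) < k → P k → P j) :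
    ∃ a ≤ m, ∀ j : Fin m, P j ↔ (j : ℕ) < a := by
  classical
  have hex : ∃ a, ∀ ha : a < m, ¬ P ⟨a, ha⟩ := ⟨m, fun ha => (lt_irrefl _ ha).elim⟩
  refine ⟨Nat.find hex, Nat.find_min' hex fun ha => (lt_irrefl _ ha).elim, fun j => ?_⟩
  constructor
  · intro hj
    by_contra! hlt
    refine Nat.find_spec hex (hlt.trans_lt j.2) ?_
    rcases hlt.lt_or_eq with hlt | heq
    · exact h _ j hlt hj
    · have : (⟨Nat.find hex, hlt.trans_lt j.2⟩ : Fin m) = j := Fin.ext heq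
      rwa [this]
  · intro hj
    have := Nat.find_min hex hj
    push Not at this
    exact this.2

/-- The elements `x^E e_J` without free indices are the polarizations of the `x^a e_J` of
multidegree at most `c`. -/
theorem exists_eq_polExp_of_not_isFree {J' : Finset (PolVar c)} {E : PolVar c →₀ ℕ}
    (h : ∀ p, ¬ IsFree Precedes p J' E) :
    ∃ a J, multideg a J ≤ c ∧ polIndex c a J = J' ∧ polExp c a = E := by
  have h1 : ∀ p, (p ∈ J' ∨ E p ≠ 0) → E p + (if p ∈ J' then 1 else 0) < 2 ∧
      ∀ q, Precedes q p → E q ≠ 0 := by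
    intro p hp
    have := h p
    rw [IsFree, not_and] at this
    have := this hp
    push Not at this
    exact this
  have h2 : ∀ i, ∃ a ≤ c i, ∀ j : Fin (c i), E (toLex ⟨i, j⟩) ≠ 0 ↔ (j : ℕ) < a := by
    intro i
    refine exists_bound_of_downward_closed (fun j : Fin (c i) => E (toLex ⟨i, j⟩) ≠ 0) ?_
    intro j k hjk hk
    exact (h1 (toLex ⟨i, k⟩) (Or.inr hk)).2 (toLex ⟨i, j⟩) ⟨rfl, hjk⟩
  choose a ha haE using h2
  have haE' : ∀ p : PolVar c, E p ≠ 0 ↔ ((ofLex p).2 : ℕ) < a (ofLex p).1 := fun p =>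
    haE (ofLex p).1 (ofLex p).2
  have hJ : ∀ p ∈ J', ((ofLex p).2 : ℕ) = a (ofLex p).1 := by
    -- Multiplicity one excludes positions inside the initial run of variables; a position beyond
    -- its end would have a gap below it.
    intro p hp
    have h3 := h1 p (Or.inl hp)
    rw [if_pos hp] at h3
    have h4 : ¬ ((ofLex p).2 : ℕ) < a (ofLex p).1 := fun h => (haE' p).2 h (by omega)
    by_contra hne
    have h5 : a (ofLex p).1 < (ofLex p).2 := by omega
    have h6 := h3.2 (toLex ⟨(ofLex p).1, ⟨a (ofLex p).1, h5.trans (ofLex p).2.2⟩⟩) ⟨rfl, h5⟩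
    exact lt_irrefl _ ((haE' _).1 h6)
  refine ⟨Finsupp.equivFunOnFinite.symm a, J'.image fun p => (ofLex p).1, ?_, ?_, ?_⟩
  · refine multideg_le_iff.2 ⟨ha, fun i hi => ?_⟩
    obtain ⟨p, hp, rfl⟩ := Finset.mem_image.1 hi
    exact (hJ p hp).symm.trans_lt (ofLex p).2.2
  · ext p
    rw [mem_polIndex, Finset.mem_image]
    constructor
    · rintro ⟨⟨q, hq, hqp⟩, hp⟩
      have : q = p := polVar_ext hqp (by rw [hJ q hq, hqp]; exact hp.symm)
      exact this ▸ hq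
    · intro hp
      exact ⟨⟨p, hp, rfl⟩, hJ p hp⟩
  · ext p
    rw [polExp_apply]
    change (if ((ofLex p).2 : ℕ) < a (ofLex p).1 then 1 else 0) = E p
    by_cases hp : E p = 0
    · rw [if_neg fun h => (haE' p).2 h hp, hp]
    · rw [if_pos ((haE' p).1 hp)]
      have := (h1 p (Or.inr hp)).1
      omega

/-- The linear extension of the polarization of the `x^a e_J` of multidegree at most `c`, by zero
on the other `x^a e_J`. -/
noncomputable def polHom (K : Type*) [Field K] (c : Fin n → ℕ) :
    (Finset (Fin n) → MvPolynomial (Fin n) K) →ₗ[K]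
      (Finset (PolVar c) → MvPolynomial (PolVar c) K) := by
  classical
  exact cellMap fun J a =>
    if multideg a J ≤ c then cell K (polIndex c a J) (polExp c a) else 0

theorem polHom_cell {a : Fin n →₀ ℕ} {J : Finset (Fin n)} (h : multideg a J ≤ c) :
    polHom K c (cell K J a) = cell K (polIndex c a J) (polExp c a) := by
  rw [polHom, cellMap_cell, if_pos h]

theorem polHom_cell_of_not {a : Fin n →₀ ℕ} {J : Finset (Fin n)} (h : ¬ multideg a J ≤ c) :
    polHom K c (cell K J a) = 0 := by
  rw [polHom, cellMap_cell, if_neg h]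

theorem polChain_eq_polHom {f : Finset (Fin n) → MvPolynomial (Fin n) K}
    (hf : f ∈ cellSpan K (fun J a => multideg a J ≤ c)) : polChain c f = polHom K c f := by
  conv_rhs => rw [eq_sum_cell f]
  simp only [map_sum, map_smul]
  refine Finset.sum_congr rfl fun J _ => Finset.sum_congr rfl fun a ha => ?_
  rw [polHom_cell (hf J a (mem_support_iff.1 ha)), polMonomial_eq]
  exact Pi.single_smul _ _ _

/-- Replacing `e_k` by `x_k` polarizes to replacing `e_{k, a_k + 1}` by `x_{k, a_k + 1}`. Extension
by zero is harmless since the differential preserves multidegrees. -/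
theorem polHom_diff (f : Finset (Fin n) → MvPolynomial (Fin n) K) :
    polHom K c (diff (Fin n) K f) = diff (PolVar c) K (polHom K c f) := by
  have : polHom K c ∘ₗ diff (Fin n) K = diff (PolVar c) K ∘ₗ polHom K c := by
    refine linearMap_ext_cells fun J a => ?_
    rw [LinearMap.comp_apply, LinearMap.comp_apply, diff_cell, map_sum]
    by_cases h : multideg a J ≤ c
    · rw [polHom_cell h, diff_cell]
      have h' := (multideg_le_iff.1 h).2
      symm
      refine Finset.sum_bij (fun p _ => (ofLex p).1) (fun _ hp => (mem_polIndex.1 hp).1)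
        (fun _ hp _ hq => eq_of_mem_polIndex hp hq)
        (fun _ hi => (exists_mem_polIndex h' hi).imp fun _ hp => ⟨hp.1, hp.2⟩) fun p hp => ?_
      have hpJ := (mem_polIndex.1 hp).1
      rw [map_smul, polHom_cell (by rwa [multideg_erase hpJ]), polIndex_erase hp,
        polExp_add_single hp, sign_polIndex h' hp]
      congr!
    · rw [polHom_cell_of_not h, map_zero]
      refine Finset.sum_eq_zero fun k hk => ?_
      rw [map_smul, polHom_cell_of_not (by rwa [multideg_erase hk]), smul_zero]
  exact LinearMap.congr_fun this f

open scoped Classical in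
/-- The inverse of polarization on the `x^E e_J` that are polarizations, extended by zero. -/
noncomputable def depolHom (K : Type*) [Field K] (c : Fin n → ℕ) :
    (Finset (PolVar c) → MvPolynomial (PolVar c) K) →ₗ[K]
      (Finset (Fin n) → MvPolynomial (Fin n) K) :=
  cellMap fun J' E =>
    if h : ∃ s : (Fin n →₀ ℕ) × Finset (Fin n),
      multideg s.1 s.2 ≤ c ∧ polIndex c s.1 s.2 = J' ∧ polExp c s.1 = E
    then cell K h.choose.2 h.choose.1 else 0

theorem depolHom_cell {a : Fin n →₀ ℕ} {J : Finset (Fin n)} (h : multideg a J ≤ c) :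
    depolHom K c (cell K (polIndex c a J) (polExp c a)) = cell K J a := by
  have hex : ∃ s : (Fin n →₀ ℕ) × Finset (Fin n),
      multideg s.1 s.2 ≤ c ∧ polIndex c s.1 s.2 = polIndex c a J ∧ polExp c s.1 = polExp c a :=
    ⟨(a, J), h, rfl, rfl⟩
  rw [depolHom, cellMap_cell, dif_pos hex]
  have hs := hex.choose_spec
  obtain ⟨h1, h2⟩ := polExp_polIndex_injective hs.1 h hs.2.2 hs.2.1
  rw [h1, h2]

theorem polHom_depolHom {f : Finset (PolVar c) → MvPolynomial (PolVar c) K}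
    (hf : f ∈ cellSpan K (fun J E => ∀ p, ¬ IsFree Precedes p J E)) :
    polHom K c (depolHom K c f) = f := by
  refine map_eq_of_cells (L := polHom K c ∘ₗ depolHom K c) (L' := LinearMap.id)
    (fun J E h => ?_) hf
  obtain ⟨a, J, hd, rfl, rfl⟩ := exists_eq_polExp_of_not_isFree h
  rw [LinearMap.comp_apply, depolHom_cell hd, polHom_cell hd, LinearMap.id_apply]

theorem depolHom_polHom {f : Finset (Fin n) → MvPolynomial (Fin n) K}
    (hf : f ∈ cellSpan K (fun J a => multideg a J ≤ c)) :
    depolHom K c (polHom K c f) = f := by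
  refine map_eq_of_cells (L := depolHom K c ∘ₗ polHom K c) (L' := LinearMap.id)
    (fun J a h => ?_) hf
  rw [LinearMap.comp_apply, polHom_cell h, depolHom_cell h, LinearMap.id_apply]

theorem polHom_mem_cellSpan {P : Finset (Fin n) → (Fin n →₀ ℕ) → Prop}
    {Q : Finset (PolVar c) → (PolVar c →₀ ℕ) → Prop}
    (h : ∀ J a, multideg a J ≤ c → P J a → Q (polIndex c a J) (polExp c a))
    {f : Finset (Fin n) → MvPolynomial (Fin n) K} (hf : f ∈ cellSpan K P) :
    polHom K c f ∈ cellSpan K Q := by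
  refine map_mem_of_cells (fun J a hJ => ?_) hf
  by_cases hd : multideg a J ≤ c
  · rw [polHom_cell hd]
    exact cell_mem_cellSpan (h J a hd hJ)
  · rw [polHom_cell_of_not hd]
    exact Submodule.zero_mem _

theorem depolHom_mem_cellSpan {P : Finset (Fin n) → (Fin n →₀ ℕ) → Prop}
    {Q : Finset (PolVar c) → (PolVar c →₀ ℕ) → Prop}
    (h : ∀ J a, multideg a J ≤ c → Q (polIndex c a J) (polExp c a) → P J a)
    {f : Finset (PolVar c) → MvPolynomial (PolVar c) K} (hf : f ∈ cellSpan K Q) :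
    depolHom K c f ∈ cellSpan K P := by
  refine map_mem_of_cells (fun J' E hJ => ?_) hf
  by_cases hex : ∃ s : (Fin n →₀ ℕ) × Finset (Fin n),
      multideg s.1 s.2 ≤ c ∧ polIndex c s.1 s.2 = J' ∧ polExp c s.1 = E
  · obtain ⟨⟨a, J⟩, hd, rfl, rfl⟩ := hex
    rw [depolHom_cell hd]
    exact cell_mem_cellSpan (h J a hd hJ)
  · rw [depolHom, cellMap_cell, dif_neg hex]
    exact Submodule.zero_mem _

end

end Polarization

/-! ### Compatibility with the ideals and transfer of the basis. -/

namespace Polarization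

open MvPolynomial Koszul

section

variable {K : Type*} [Field K] {n : ℕ}

theorem forall_mem_span_monomial_iff {σ : Type*} [LinearOrder σ] (A : Set (σ →₀ ℕ))
    (f : Finset σ → MvPolynomial σ K) :
    (∀ J, f J ∈ Ideal.span ((fun a => monomial a (1 : K)) '' A)) ↔
      f ∈ cellSpan K (fun _ a => ∃ g ∈ A, g ≤ a) := by
  simp only [mem_ideal_span_monomial_image, mem_support_iff]
  rfl

theorem IsMonomialIdeal.eq_span_minGens {I : Ideal (MvPolynomial (Fin n) K)}
    (hI : IsMonomialIdeal I) :
    I = Ideal.span ((fun a => monomial a (1 : K)) '' minGens I) := by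
  refine le_antisymm ?_ (Ideal.span_le.2 ?_)
  · obtain ⟨A, hA⟩ := hI
    intro f hf
    rw [mem_ideal_span_monomial_image]
    intro a ha
    rw [hA, mem_ideal_span_monomial_image] at hf
    obtain ⟨b, hb, hba⟩ := hf a ha
    have hbI : monomial b (1 : K) ∈ I := by
      rw [hA]; exact Ideal.subset_span ⟨b, hb, rfl⟩
    obtain ⟨g, hgb, hg⟩ := exists_minimal_le_of_wellFoundedLT
      (fun b : Fin n →₀ ℕ => monomial b (1 : K) ∈ I) b hbI
    exact ⟨g, hg, hgb.trans hba⟩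
  · rintro _ ⟨a, ha, rfl⟩
    exact Minimal.prop (P := fun b : Fin n →₀ ℕ => monomial b (1 : K) ∈ I) ha

theorem polIdeal_eq (I : Ideal (MvPolynomial (Fin n) K)) :
    polIdeal I = Ideal.span ((fun a => monomial a (1 : K)) '' (polExp (maxDeg I) '' minGens I)) := by
  rw [polIdeal, Set.image_image]
  simp only [← polMonomial_eq]

theorem le_maxDeg {I : Ideal (MvPolynomial (Fin n) K)} {g : Fin n →₀ ℕ} (hg : g ∈ minGens I)
    (i : Fin n) : g i ≤ maxDeg I i :=
  Finset.le_sup (f := fun a : Fin n →₀ ℕ => a i) ((minGens_finite I).mem_toFinset.2 hg)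

/-- Polarized generators are squarefree, and each is divisible by all predecessors of any variable
dividing it. -/
theorem toggleClosed_polExp {c : Fin n → ℕ} (A : Set (Fin n →₀ ℕ)) :
    ToggleClosed Precedes (fun E => ∃ g ∈ polExp c '' A, g ≤ E) := by
  constructor
  · rintro E k ⟨g, hg, hgE⟩
    exact ⟨g, hg, hgE.trans le_self_add⟩
  · rintro E p ⟨_, ⟨g, hg, rfl⟩, hgE⟩ h
    refine ⟨_, ⟨g, hg, rfl⟩, fun q => ?_⟩
    by_cases hqp : q = p
    · subst hqp
      rw [polExp_apply]
      split_ifs with hlt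
      · rcases h with h | ⟨s, ⟨hs, hs'⟩, hE⟩
        · omega
        · have hsq : s ≠ q := by rintro rfl; exact lt_irrefl _ hs'
          have h1 := hgE s
          rw [polExp_apply, if_pos ((hs'.trans hlt).trans_eq (by rw [hs])), Finsupp.add_apply, hE,
            Finsupp.single_eq_of_ne hsq] at h1
          omega
      · exact Nat.zero_le _
    · have := hgE q
      rwa [Finsupp.add_apply, Finsupp.single_eq_of_ne hqp, add_zero] at this

/-- The composite is the projection onto multidegrees `≤ c`, which the differential preserves. -/
theorem depolHom_polHom_diff {c : Fin n → ℕ} (f : Finset (Fin n) → MvPolynomial (Fin n) K) :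
    depolHom K c (polHom K c (diff (Fin n) K f)) =
      diff (Fin n) K (depolHom K c (polHom K c f)) := by
  have : depolHom K c ∘ₗ polHom K c ∘ₗ diff (Fin n) K =
      diff (Fin n) K ∘ₗ depolHom K c ∘ₗ polHom K c := by
    refine linearMap_ext_cells fun J a => ?_
    simp only [LinearMap.comp_apply]
    by_cases h : multideg a J ≤ c
    · have h1 : cell K J a ∈ cellSpan K (fun J a => multideg a J ≤ c) := cell_mem_cellSpan h
      rw [depolHom_polHom h1, depolHom_polHom]
      exact diff_mem_cellSpan (fun J a hJ k hk => by rwa [multideg_erase hk]) h1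
    · rw [polHom_diff, polHom_cell_of_not h]
      simp only [map_zero]
  exact LinearMap.congr_fun this f

theorem polHom_mem_not_isFree {c : Fin n → ℕ} (f : Finset (Fin n) → MvPolynomial (Fin n) K) :
    polHom K c f ∈ cellSpan K (fun J E => ∀ p, ¬ IsFree Precedes p J E) :=
  polHom_mem_cellSpan (P := fun _ _ => True) (fun J a _ _ => not_isFree_polIndex a J)
    fun _ _ _ => trivial

theorem polHom_mem_chains {c : Fin n → ℕ} {i : ℕ} {f : Finset (Fin n) → MvPolynomial (Fin n) K}
    (hf : f ∈ cellSpan K (fun J _ => J.card = i)) :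
    polHom K c f ∈ cellSpan K (fun J _ => J.card = i) :=
  polHom_mem_cellSpan
    (fun _ _ hd hJ => (polIndex_card (multideg_le_iff.1 hd).2).trans hJ) hf

theorem depolHom_mem_chains {c : Fin n → ℕ} {i : ℕ}
    {f : Finset (PolVar c) → MvPolynomial (PolVar c) K}
    (hf : f ∈ cellSpan K (fun J _ => J.card = i)) :
    depolHom K c f ∈ cellSpan K (fun J _ => J.card = i) :=
  depolHom_mem_cellSpan
    (fun _ _ hd hJ => (polIndex_card (multideg_le_iff.1 hd).2).symm.trans hJ) hf

theorem polHom_mem_ideal {c : Fin n → ℕ} {A : Set (Fin n →₀ ℕ)} (hA : ∀ g ∈ A, ∀ i, g i ≤ c i)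
    {f : Finset (Fin n) → MvPolynomial (Fin n) K}
    (hf : f ∈ cellSpan K (fun _ a => ∃ g ∈ A, g ≤ a)) :
    polHom K c f ∈ cellSpan K (fun _ E => ∃ g ∈ polExp c '' A, g ≤ E) := by
  refine polHom_mem_cellSpan (fun J a hd => ?_) hf
  rintro ⟨g, hg, hga⟩
  exact ⟨_, ⟨g, hg, rfl⟩, (polExp_le_iff (hA g hg)).2 hga⟩

theorem depolHom_mem_ideal {c : Fin n → ℕ} {A : Set (Fin n →₀ ℕ)} (hA : ∀ g ∈ A, ∀ i, g i ≤ c i)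
    {f : Finset (PolVar c) → MvPolynomial (PolVar c) K}
    (hf : f ∈ cellSpan K (fun _ E => ∃ g ∈ polExp c '' A, g ≤ E)) :
    depolHom K c f ∈ cellSpan K (fun _ a => ∃ g ∈ A, g ≤ a) := by
  refine depolHom_mem_cellSpan (fun J a hd => ?_) hf
  rintro ⟨_, ⟨g, hg, rfl⟩, hga⟩
  exact ⟨g, hg, (polExp_le_iff (hA g hg)).1 hga⟩

/-- If multihomogeneous elements of multidegrees at most `c` represent a basis of `H_i(x; S/I)`,
then their polarizations represent a basis of the Koszul homology of the polarization of `I`. -/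
theorem representBasis_polChain (I : Ideal (MvPolynomial (Fin n) K))
    (hI : IsMonomialIdeal I) (i : ℕ) (hi : 1 ≤ i) (r : ℕ)
    (z : Fin r → Finset (Fin n) → MvPolynomial (Fin n) K)
    (hz_chain : ∀ k, z k ∈ chains (Fin n) (MvPolynomial (Fin n) K)
      (MvPolynomial (Fin n) K) i)
    (hz_deg : ∀ k, ∃ d : Fin n → ℕ, d ≤ maxDeg I ∧
      IsMultihomogeneous (z k) d)
    (hz_basis : RepresentBasis K
      (fun j : Fin n => (X j : MvPolynomial (Fin n) K)) i
      (fun k => residue I (z k))) :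
    RepresentBasis K
      (fun p : PolVar (maxDeg I) =>
        (X p : MvPolynomial (PolVar (maxDeg I)) K)) i
      (fun k => residue (polIdeal I)
        (polChain (maxDeg I) (z k))) := by
  have hA : ∀ g ∈ minGens I, ∀ i, g i ≤ maxDeg I i := fun g hg i => le_maxDeg hg i
  have hz_le : ∀ k, z k ∈ cellSpan K (fun J a => multideg a J ≤ (maxDeg I)) := by
    intro k J a ha
    obtain ⟨d, hd, hdz⟩ := hz_deg k
    exact (hdz J a (mem_support_iff.2 ha)).trans_le hd
  have hz_pol : ∀ k, polChain (maxDeg I) (z k) = polHom K (maxDeg I) (z k) := fun k => polChain_eq_polHom (hz_le k)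
  have hIm : ∀ f : Finset (Fin n) → MvPolynomial (Fin n) K, (∀ J, f J ∈ I) ↔
      f ∈ cellSpan K (fun _ a => ∃ g ∈ minGens I, g ≤ a) := by
    intro f
    rw [← forall_mem_span_monomial_iff, ← hI.eq_span_minGens]
  have hIp : ∀ f : Finset (PolVar (maxDeg I)) → MvPolynomial (PolVar (maxDeg I)) K, (∀ J, f J ∈ polIdeal I) ↔
      f ∈ cellSpan K (fun _ a => ∃ g ∈ polExp (maxDeg I) '' minGens I, g ≤ a) := by
    intro f
    rw [← forall_mem_span_monomial_iff, ← polIdeal_eq]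
  have hchain := (representBasis_residue_iff (K := K) _ I i z hz_chain).1 hz_basis
  simp only [← diff_apply, hIm, mem_chains_iff_mem_cellSpan] at hchain hz_chain
  obtain ⟨hz1, hz2, hz3⟩ := hchain
  simp only [hz_pol]
  rw [representBasis_residue_iff _ _ _ _
    fun k => mem_chains_iff_mem_cellSpan.2 (polHom_mem_chains (hz_chain k))]
  simp only [← diff_apply, hIp, mem_chains_iff_mem_cellSpan]
  obtain ⟨H, hH1, hH2, hH3, hH4⟩ := exists_homotopy_no_free (K := K)
    (r := (Precedes : PolVar (maxDeg I) → PolVar (maxDeg I) → Prop)) precedes_irrefl fun _ _ _ => Precedes.trans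
  have hH4' := hH4 _ (toggleClosed_polExp (c := maxDeg I) (minGens I))
  have hdI : ∀ f ∈ cellSpan K (fun _ E => ∃ g ∈ polExp (maxDeg I) '' minGens I, g ≤ E),
      diff (PolVar (maxDeg I)) K f ∈ cellSpan K (fun _ E => ∃ g ∈ polExp (maxDeg I) '' minGens I, g ≤ E) :=
    fun f hf => diff_mem_cellSpan
      (fun _ a ha k _ => (toggleClosed_polExp (c := maxDeg I) (minGens I)).1 a k ha) hf
  -- The retraction onto the span of cells without free indices: a chain map preserving `I^℘` and
  -- fixing all polarizations.
  set ψ : (Finset (PolVar (maxDeg I)) → MvPolynomial (PolVar (maxDeg I)) K) →ₗ[K]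
      (Finset (PolVar (maxDeg I)) → MvPolynomial (PolVar (maxDeg I)) K) :=
    LinearMap.id - diff (PolVar (maxDeg I)) K ∘ₗ H - H ∘ₗ diff (PolVar (maxDeg I)) K with hψdef
  have hψ : ∀ f, ψ f = f - diff (PolVar (maxDeg I)) K (H f) - H (diff (PolVar (maxDeg I)) K f) := fun f => rfl
  have hψ1 : ∀ f, ψ f ∈ cellSpan K (fun J E => ∀ p, ¬ IsFree Precedes p J E) := hH1
  have hψd : ∀ f, ψ (diff (PolVar (maxDeg I)) K f) = diff (PolVar (maxDeg I)) K (ψ f) := by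
    intro f
    simp only [hψ, map_sub, diff_diff, map_zero, sub_zero]
  have hψP : ∀ f, ψ (polHom K (maxDeg I) f) = polHom K (maxDeg I) f := by
    intro f
    rw [hψ, ← polHom_diff, hH2 _ (polHom_mem_not_isFree _), hH2 _ (polHom_mem_not_isFree _),
      map_zero, sub_zero, sub_zero]
  have hψI : ∀ f ∈ cellSpan K (fun _ E => ∃ g ∈ polExp (maxDeg I) '' minGens I, g ≤ E),
      ψ f ∈ cellSpan K (fun _ E => ∃ g ∈ polExp (maxDeg I) '' minGens I, g ≤ E) := fun f hf =>
    Submodule.sub_mem _ (Submodule.sub_mem _ hf (hdI _ (hH4' _ hf))) (hH4' _ (hdI _ hf))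
  have hψch : ∀ j, 1 ≤ j → ∀ f ∈ cellSpan K (fun (J : Finset (PolVar (maxDeg I))) _ => J.card = j),
      ψ f ∈ cellSpan K (fun J _ => J.card = j) := by
    intro j hj f hf
    obtain ⟨j, rfl⟩ := Nat.exists_eq_add_of_le' hj
    exact Submodule.sub_mem _ (Submodule.sub_mem _ hf (diff_mem_chains (hH3 _ _ hf)))
      (hH3 _ _ (diff_mem_chains hf))
  have hPsum : ∀ l : Fin r → K, ∑ k, l k • polHom K (maxDeg I) (z k) = polHom K (maxDeg I) (∑ k, l k • z k) := by
    intro l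
    simp only [map_sum, map_smul]
  refine ⟨fun k => ?_, fun l w hw hlw => ?_, fun g hg hdg => ?_⟩
  · rw [← polHom_diff]
    exact polHom_mem_ideal hA (hz1 k)
  -- Retracting and depolarizing a relation among the `z_k^℘` gives one among the `z_k`, which are
  -- recovered because their multidegrees are `≤ c`.
  · refine hz2 l (depolHom K (maxDeg I) (ψ w)) (depolHom_mem_chains (hψch _ (by omega) _ hw)) ?_
    have h1 := depolHom_mem_ideal hA (hψI _ hlw)
    rw [map_sub, hPsum, hψP, hψd, ← polHom_depolHom (hψ1 w), ← polHom_diff, map_sub,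
      depolHom_polHom_diff, depolHom_polHom (Submodule.sum_mem _ fun k _ =>
        Submodule.smul_mem _ _ (hz_le k)), polHom_depolHom (hψ1 w)] at h1
    exact h1
  · have hψg : depolHom K (maxDeg I) (ψ g) ∈ cellSpan K (fun J _ => J.card = i) :=
      depolHom_mem_chains (hψch i hi g hg)
    have h1 : diff (Fin n) K (depolHom K (maxDeg I) (ψ g)) ∈
        cellSpan K (fun _ a => ∃ g ∈ minGens I, g ≤ a) := by
      have := depolHom_mem_ideal hA (hψI _ hdg)
      rw [hψd, ← polHom_depolHom (hψ1 g), ← polHom_diff, depolHom_polHom_diff,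
        polHom_depolHom (hψ1 g)] at this
      exact this
    obtain ⟨l, w, hw, hlw⟩ := hz3 _ hψg h1
    -- The term `H g` accounts for the boundary by which `g` and `ψ g` differ; the remaining
    -- difference `H (∂ g)` lies in `I^℘` since `∂ g` does.
    refine ⟨l, polHom K (maxDeg I) w + H g, Submodule.add_mem _ (polHom_mem_chains hw) (hH3 _ _ hg), ?_⟩
    have h2 := polHom_mem_ideal hA hlw
    rw [map_sub, map_sub, polHom_depolHom (hψ1 g), polHom_diff, ← hPsum] at h2
    have h3 := Submodule.add_mem _ h2 (hH4' _ hdg)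
    convert h3 using 1
    rw [hψ, map_add]
    abel

end

end Polarization

theorem corollary1p3 {K : Type*} [Field K] (n : ℕ) (I : Ideal (MvPolynomial (Fin n) K))
    (hI : Polarization.IsMonomialIdeal I) (i : ℕ) (hi : 1 ≤ i) (r : ℕ)
    -- the cycles in `K_i(x; S/I)` are given by representatives `z k` in `K_i(x; S)`
    (z : Fin r → Finset (Fin n) → MvPolynomial (Fin n) K)
    (hz_chain : ∀ k, z k ∈ Koszul.chains (Fin n) (MvPolynomial (Fin n) K)
      (MvPolynomial (Fin n) K) i)
    (hz_deg : ∀ k, ∃ d : Fin n → ℕ, d ≤ Polarization.maxDeg I ∧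
      Polarization.IsMultihomogeneous (z k) d)
    (hz_basis : Koszul.RepresentBasis K
      (fun j : Fin n => (MvPolynomial.X j : MvPolynomial (Fin n) K)) i
      (fun k => Koszul.residue I (z k))) :
    Koszul.RepresentBasis K
      (fun p : Polarization.PolVar (Polarization.maxDeg I) =>
        (MvPolynomial.X p : MvPolynomial (Polarization.PolVar (Polarization.maxDeg I)) K)) i
      (fun k => Koszul.residue (Polarization.polIdeal I)
        (Polarization.polChain (Polarization.maxDeg I) (z k))) :=
  Polarization.representBasis_polChain I hI i hi r z hz_chain hz_deg hz_basis
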